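/- A list $\{d_{ij} : i\neq j\in\{1,2,3,4\}\}$ of real numbers is called tetrahedral if there are four distinct points $V_1,\dots,V_4\in\mathbb{R}^3$ with $d_{ij}=\|V_i-V_j\|$ for all $i\neq j$. Its unit lengthening is the list $\{d_{ij}+1\}$. Theorem. The unit lengthening of a tetrahedral list is tetrahedral. Moreover, if the points $V_1,\dots,V_4$ realizing $\{d_{ij}\}$ are affinely independent, with convex hull the (non-degenerate) tetrahedron $\Delta_0$, and $W_1,\dots,W_4\in\mathbb{R}^3$ are any points with $\|W_i-W_j\|=d_{ij}+1$ for all $i\neq j$, with convex hull $\Delta_1$, then $W_1,\dots,W_4$ are affinely independent and $$\frac{\mathrm{vol}(\Delta_1)}{\mathrm{vol}(\Delta_0)}\ \ge\ \Bigl(1+\frac{6}{\sum_{i<j}d_{ij}}\Bigr)^3,$$ with equality whenever $\Delta_0$ is a regular tetrahedron (all $d_{ij}$ equal). -/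

import Mathlib

open MeasureTheory

/-- Euclidean three-space. -/
abbrev R3 : Type := EuclideanSpace ℝ (Fin 3)

/-- The points `V 0, …, V 3` realize the list of edge lengths `d`. Only the entries `d i j` with
`i ≠ j` belong to the list; the diagonal entries of `d` carry no meaning. -/
def Realizes (V : Fin 4 → R3) (d : Fin 4 → Fin 4 → ℝ) : Prop :=
  ∀ i j, i ≠ j → d i j = ‖V i - V j‖

/-- A list is tetrahedral if it is the list of mutual distances of four distinct points. -/
def IsTetrahedral (d : Fin 4 → Fin 4 → ℝ) : Prop :=
  ∃ V : Fin 4 → R3, Function.Injective V ∧ Realizes V d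

/-- The unit lengthening adds one to every edge length. -/
def unitLengthening (d : Fin 4 → Fin 4 → ℝ) : Fin 4 → Fin 4 → ℝ :=
  fun i j => d i j + 1

/-- The sum of the six edge lengths. -/
noncomputable def edgeSum (d : Fin 4 → Fin 4 → ℝ) : ℝ :=
  ∑ p : Fin 4 × Fin 4 with p.1 < p.2, d p.1 p.2

/-- The volume (Lebesgue measure) of the solid tetrahedron with vertices `V 0, …, V 3`. -/
noncomputable def tetVolume (V : Fin 4 → R3) : ℝ :=
  (volume : Measure R3).real (convexHull ℝ (Set.range V))

/-!
For edge lengths `d i j`, the squares of the lengthened edges are `d² + 2 d + 1`. A symmetric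
function of pairs of vertices defines, by polarization from the vertex `0`, a quadratic form on `ℝ³`
(`dissimGram`), linearly in the function, and squared distances give the Gram matrix of the edge
vectors. So the Gram matrix of the lengthened tetrahedron is `M = A + 2 B + C`, where `A`, `B`, `C`
are the forms of `d²`, of `d` and of the constant `1`.

Any metric on four points is a nonnegative combination of cut metrics, and a cut metric gives the
square of a linear form. Hence `B` is positive semidefinite (`posSemidef_dissimGram`), and since `C`
is positive definite so is `M`; it is therefore the Gram matrix of an affinely independent
quadruple of points. This gives existence, and affine independence of every realization.

The volume is proportional to the square root of the Gram determinant
(`tetVolume_eq_sqrt_det_gram`), so the volume bound says `det M ≥ det A * (1 + r) ^ 6` with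
`r = 6 / ∑ d`. It follows from three inequalities:

* `det A * det C ≤ (det B) ^ 2` (`det_dissimGram_sq_le`), which in the cut weights is a sum of
  squares with nonnegative coefficients (`cut_sum_of_squares`);
* `det B ≤ r⁻¹ ^ 3 * det C` (`det_dissimGram_le_edgeSum`), the arithmetic-geometric mean inequality
  for the eigenvalues of `C⁻¹ B`, whose trace is half the edge sum;
* Minkowski's inequality, that `det ^ (1 / 3)` is superadditive on positive semidefinite matrices
  (`det_mul_pow_le_det_add`).

The first two give `det B ≥ r ^ 3 * det A` and `det C ≥ r ^ 6 * det A`, and then the third gives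
`det M ^ (1 / 3) ≥ (1 + 2 r + r ^ 2) * det A ^ (1 / 3)`. If all edges are equal, `A` and `M` are
multiples of `C` and both determinants are explicit.
-/

/-! ### Four-point metrics and cuts -/

/-- The Gram-type matrix of a dissimilarity `x` on four points with base point `0`. When `x i j` is
the squared distance of `V i` and `V j`, it is the Gram matrix of the vectors `V i - V 0`, `i ≠ 0`,
by polarization; the definition is used for other `x` too because it is linear in `x`. The function
`x` is meant to be symmetric and to vanish on the diagonal. -/
noncomputable def dissimGram (x : Fin 4 → Fin 4 → ℝ) : Matrix (Fin 3) (Fin 3) ℝ :=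
  Matrix.of fun i j => (x i.succ 0 + x j.succ 0 - x i.succ j.succ) / 2

/-- The determinant of `dissimGram` as a polynomial in the six values `x i j`, `i < j`
(up to normalization, the Cayley–Menger determinant). -/
noncomputable def cayleyMenger (x01 x02 x03 x12 x13 x23 : ℝ) : ℝ :=
  x01 * (x02 * x03 - ((x02 + x03 - x23) / 2) ^ 2)
    - (x01 + x02 - x12) / 2 *
        ((x01 + x02 - x12) / 2 * x03 - (x02 + x03 - x23) / 2 * ((x01 + x03 - x13) / 2))
    + (x01 + x03 - x13) / 2 *
        ((x01 + x02 - x12) / 2 * ((x02 + x03 - x23) / 2) - x02 * ((x01 + x03 - x13) / 2))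

lemma det_dissimGram (x : Fin 4 → Fin 4 → ℝ) (hs : ∀ i j, x i j = x j i) (h0 : ∀ i, x i i = 0) :
    (dissimGram x).det = cayleyMenger (x 0 1) (x 0 2) (x 0 3) (x 1 2) (x 1 3) (x 2 3) := by
  have e1 : (Fin.succ 0 : Fin 4) = 1 := rfl
  have e2 : (Fin.succ 1 : Fin 4) = 2 := rfl
  have e3 : (Fin.succ 2 : Fin 4) = 3 := rfl
  simp only [Matrix.det_fin_three, dissimGram, Matrix.of_apply, e1, e2, e3, h0,
    hs 1 0, hs 2 0, hs 3 0, hs 2 1, hs 3 1, hs 3 2, cayleyMenger]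
  ring

lemma cayleyMenger_swap_two_three (x01 x02 x03 x12 x13 x23 : ℝ) :
    cayleyMenger x01 x03 x02 x13 x12 x23 = cayleyMenger x01 x02 x03 x12 x13 x23 := by
  unfold cayleyMenger; ring

lemma cayleyMenger_swap_one_three (x01 x02 x03 x12 x13 x23 : ℝ) :
    cayleyMenger x03 x02 x01 x23 x13 x12 = cayleyMenger x01 x02 x03 x12 x13 x23 := by
  unfold cayleyMenger; ring

/-- The determinant inequality in cut coordinates. The distances are nonnegative combinations of the
metrics of six cuts: `x`, `y`, `z`, `t` weigh the cuts isolating the vertices `0`, `1`, `2`, `3`,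
and `a`, `b` weigh the cuts `01|23`, `02|13`. In these coordinates the difference of the two sides is
a sum of squares with nonnegative coefficients. -/
lemma cut_sum_of_squares (x y z t a b : ℝ) (hx : 0 ≤ x) (hy : 0 ≤ y) (hz : 0 ≤ z) (ht : 0 ≤ t)
    (ha : 0 ≤ a) (hb : 0 ≤ b) :
    cayleyMenger ((x + y + b) ^ 2) ((x + z + a) ^ 2) ((x + t + a + b) ^ 2) ((y + z + a + b) ^ 2)
        ((y + t + a) ^ 2) ((z + t + b) ^ 2) ≤
      2 * cayleyMenger (x + y + b) (x + z + a) (x + t + a + b) (y + z + a + b)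
        (y + t + a) (z + t + b) ^ 2 := by
  rw [← sub_nonneg]
  have key : 2 * cayleyMenger (x + y + b) (x + z + a) (x + t + a + b) (y + z + a + b)
        (y + t + a) (z + t + b) ^ 2 -
      cayleyMenger ((x + y + b) ^ 2) ((x + z + a) ^ 2) ((x + t + a + b) ^ 2) ((y + z + a + b) ^ 2)
        ((y + t + a) ^ 2) ((z + t + b) ^ 2) =
      2 * ((y * z * t - x * z * t) ^ 2 + (y * z * t - x * y * t) ^ 2 + (y * z * t - x * y * z) ^ 2
        + (x * z * t - x * y * t) ^ 2 + (x * z * t - x * y * z) ^ 2 + (x * y * t - x * y * z) ^ 2)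
      + 4 * b * ((x ^ 2 * z + z ^ 2 * x) * (y - t) ^ 2 + (y ^ 2 * t + t ^ 2 * y) * (x - z) ^ 2)
      + 4 * a * ((x ^ 2 * y + y ^ 2 * x) * (z - t) ^ 2 + (z ^ 2 * t + t ^ 2 * z) * (x - y) ^ 2)
      + 2 * b ^ 2 * ((x * y - z * t) ^ 2 + (x * t - y * z) ^ 2)
      + 2 * a ^ 2 * ((x * z - y * t) ^ 2 + (x * t - y * z) ^ 2)
      + 4 * (a * b) * (x * t - y * z) ^ 2
      + 4 * a ^ 2 * (z * t * (x - y) ^ 2 + x * y * (z - t) ^ 2)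
      + 4 * b ^ 2 * (y * t * (x - z) ^ 2 + x * z * (y - t) ^ 2)
      + 16 * (x * y * z * t) * ((a - b) ^ 2 + a * b)
      + a ^ 2 * b ^ 2 * (4 * (a + b) ^ 2 + 8 * (a + b) * (x + y + z + t)
        + 6 * (x + y + z + t) ^ 2)
      + 4 * (a ^ 2 * b) * (x * z * (x + z) + x * t * (x + t) + y * z * (y + z) + y * t * (y + t))
      + 4 * (a * b ^ 2) * (x * y * (x + y) + x * t * (x + t) + y * z * (y + z) + z * t * (z + t))
      := by
    unfold cayleyMenger; ring
  rw [key]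
  positivity

/-- Both consequences of the cut decomposition, for a metric in which `x03 + x12` is the largest of
the three sums of opposite distances: the cut `03|12` then gets weight zero, and the triangle
inequalities make the other weights nonnegative. -/
lemma four_point_of_max (x01 x02 x03 x12 x13 x23 : ℝ)
    (h0 : x12 ≤ x01 + x02) (h1 : x03 ≤ x01 + x13) (h2 : x03 ≤ x02 + x23) (h3 : x12 ≤ x13 + x23)
    (hP : x01 + x23 ≤ x03 + x12) (hQ : x02 + x13 ≤ x03 + x12) :
    cayleyMenger (x01 ^ 2) (x02 ^ 2) (x03 ^ 2) (x12 ^ 2) (x13 ^ 2) (x23 ^ 2) ≤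
        2 * cayleyMenger x01 x02 x03 x12 x13 x23 ^ 2 ∧
      ∀ c0 c1 c2 c3 : ℝ, c0 + c1 + c2 + c3 = 0 →
        x01 * (c0 * c1) + x02 * (c0 * c2) + x03 * (c0 * c3) + x12 * (c1 * c2) + x13 * (c1 * c3)
          + x23 * (c2 * c3) ≤ 0 := by
  -- the weights of the four cuts isolating a vertex and of the cuts `01|23`, `02|13`
  obtain ⟨x, hx⟩ : ∃ x, x = (x01 + x02 - x12) / 2 := ⟨_, rfl⟩
  obtain ⟨y, hy⟩ : ∃ y, y = (x01 + x13 - x03) / 2 := ⟨_, rfl⟩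
  obtain ⟨z, hz⟩ : ∃ z, z = (x02 + x23 - x03) / 2 := ⟨_, rfl⟩
  obtain ⟨t, ht⟩ : ∃ t, t = (x13 + x23 - x12) / 2 := ⟨_, rfl⟩
  obtain ⟨a, ha⟩ : ∃ a, a = (x03 + x12 - x01 - x23) / 2 := ⟨_, rfl⟩
  obtain ⟨b, hb⟩ : ∃ b, b = (x03 + x12 - x02 - x13) / 2 := ⟨_, rfl⟩
  have hx' : 0 ≤ x := by linarith
  have hy' : 0 ≤ y := by linarith
  have hz' : 0 ≤ z := by linarith
  have ht' : 0 ≤ t := by linarith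
  have ha' : 0 ≤ a := by linarith
  have hb' : 0 ≤ b := by linarith
  obtain rfl : x01 = x + y + b := by linarith
  obtain rfl : x02 = x + z + a := by linarith
  obtain rfl : x03 = x + t + a + b := by linarith
  obtain rfl : x12 = y + z + a + b := by linarith
  obtain rfl : x13 = y + t + a := by linarith
  obtain rfl : x23 = z + t + b := by linarith
  refine ⟨cut_sum_of_squares x y z t a b hx' hy' hz' ht' ha' hb', fun c0 c1 c2 c3 hc => ?_⟩
  obtain rfl : c3 = -(c0 + c1 + c2) := by linarith
  have : 0 ≤ x * c0 ^ 2 + y * c1 ^ 2 + z * c2 ^ 2 + t * (c0 + c1 + c2) ^ 2 + a * (c0 + c1) ^ 2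
      + b * (c0 + c2) ^ 2 := by positivity
  linarith

/-- The conclusion of `four_point_of_max` without an assumption on the largest sum of opposite
distances, which may be moved to `x03 + x12` by relabelling the vertices. -/
lemma four_point (x01 x02 x03 x12 x13 x23 : ℝ)
    (h012 : x12 ≤ x01 + x02) (h013 : x13 ≤ x01 + x03) (h023 : x23 ≤ x02 + x03)
    (h102 : x02 ≤ x01 + x12) (h103 : x03 ≤ x01 + x13) (h123 : x23 ≤ x12 + x13)
    (h201 : x01 ≤ x02 + x12) (h203 : x03 ≤ x02 + x23) (h213 : x13 ≤ x12 + x23)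
    (h301 : x01 ≤ x03 + x13) (h302 : x02 ≤ x03 + x23) (h312 : x12 ≤ x13 + x23) :
    cayleyMenger (x01 ^ 2) (x02 ^ 2) (x03 ^ 2) (x12 ^ 2) (x13 ^ 2) (x23 ^ 2) ≤
        2 * cayleyMenger x01 x02 x03 x12 x13 x23 ^ 2 ∧
      ∀ c0 c1 c2 c3 : ℝ, c0 + c1 + c2 + c3 = 0 →
        x01 * (c0 * c1) + x02 * (c0 * c2) + x03 * (c0 * c3) + x12 * (c1 * c2) + x13 * (c1 * c3)
          + x23 * (c2 * c3) ≤ 0 := by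
  by_cases hR : x01 + x23 ≤ x03 + x12 ∧ x02 + x13 ≤ x03 + x12
  · exact four_point_of_max _ _ _ _ _ _ h012 h103 h203 h312 hR.1 hR.2
  by_cases hQ : x01 + x23 ≤ x02 + x13 ∧ x03 + x12 ≤ x02 + x13
  · obtain ⟨h, h'⟩ := four_point_of_max x01 x03 x02 x13 x12 x23 (by linarith) (by linarith)
      (by linarith) (by linarith) (by linarith) (by linarith)
    rw [cayleyMenger_swap_two_three x01 x02 x03, cayleyMenger_swap_two_three (x01 ^ 2)] at h
    exact ⟨h, fun c0 c1 c2 c3 hc => by linarith [h' c0 c1 c3 c2 (by linarith)]⟩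
  · have hP : x03 + x12 ≤ x01 + x23 ∧ x02 + x13 ≤ x01 + x23 := by
      by_contra hP
      grind
    obtain ⟨h, h'⟩ := four_point_of_max x03 x02 x01 x23 x13 x12 (by linarith) (by linarith)
      (by linarith) (by linarith) (by linarith) (by linarith)
    rw [cayleyMenger_swap_one_three x01 x02 x03, cayleyMenger_swap_one_three (x01 ^ 2)] at h
    exact ⟨h, fun c0 c1 c2 c3 hc => by linarith [h' c0 c3 c2 c1 (by linarith)]⟩

/-! ### Determinants and traces of positive semidefinite matrices -/

lemma Matrix.PosSemidef.det_le_trace_pow {X : Matrix (Fin 3) (Fin 3) ℝ} (hX : X.PosSemidef) :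
    27 * X.det ≤ X.trace ^ 3 := by
  have h := hX.eigenvalues_nonneg
  rw [hX.isHermitian.det_eq_prod_eigenvalues, hX.isHermitian.trace_eq_sum_eigenvalues]
  simp only [Fin.prod_univ_three, Fin.sum_univ_three, RCLike.ofReal_real_eq_id, id]
  generalize hX.isHermitian.eigenvalues = l at h
  have h0 := h 0
  have h1 := h 1
  have h2 := h 2
  have key : (l 0 + l 1 + l 2) ^ 3 - 27 * (l 0 * l 1 * l 2) =
      (l 0 + l 1 + l 2) / 2 * ((l 0 - l 1) ^ 2 + (l 0 - l 2) ^ 2 + (l 1 - l 2) ^ 2)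
      + 3 * (l 0 * (l 1 - l 2) ^ 2 + l 1 * (l 0 - l 2) ^ 2 + l 2 * (l 0 - l 1) ^ 2) := by ring
  rw [← sub_nonneg, key]
  positivity

open scoped MatrixOrder in
/-- The inequality of arithmetic and geometric means for the eigenvalues of `N * X`, which are those
of the positive semidefinite matrix `K * X * Kᴴ` when `N = Kᴴ * K`. -/
lemma Matrix.PosSemidef.det_mul_det_le_trace_pow {N X : Matrix (Fin 3) (Fin 3) ℝ}
    (hN : N.PosSemidef) (hX : X.PosSemidef) :
    27 * (N.det * X.det) ≤ (N * X).trace ^ 3 := by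
  obtain ⟨K, rfl⟩ := CStarAlgebra.nonneg_iff_eq_star_mul_self.mp hN.nonneg
  have h := (hX.mul_mul_conjTranspose_same K).det_le_trace_pow
  rw [Matrix.star_eq_conjTranspose, Matrix.mul_assoc, Matrix.trace_mul_comm]
  simp only [Matrix.det_mul] at h ⊢
  linarith

lemma exists_cube_root {c : ℝ} (hc : 0 ≤ c) : ∃ m : ℝ, 0 ≤ m ∧ m ^ 3 = c :=
  ⟨c ^ ((3 : ℕ) : ℝ)⁻¹, Real.rpow_nonneg hc _, Real.rpow_inv_natCast_pow hc (by norm_num)⟩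

/-- A form of Minkowski's determinant inequality: `det ^ (1 / 3)` is superadditive on positive
semidefinite matrices, so `det (A + 2 B + C) ^ (1 / 3) ≥ det A ^ (1 / 3) * (1 + 2 r + r ^ 2)` when
the determinants of `B` and `C` are at least `r ^ 3` and `r ^ 6` times that of `A`. -/
lemma det_mul_pow_le_det_add {A B C : Matrix (Fin 3) (Fin 3) ℝ} {r : ℝ} (hr : 0 ≤ r)
    (hA : A.PosSemidef) (hB : B.PosSemidef) (hC : C.PosSemidef)
    (hM : (A + (2 : ℝ) • B + C).PosDef)
    (hAB : A.det * r ^ 3 ≤ B.det) (hAC : A.det * r ^ 6 ≤ C.det) :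
    A.det * (1 + r) ^ 6 ≤ (A + (2 : ℝ) • B + C).det := by
  set M := A + (2 : ℝ) • B + C with hMdef
  have hd := hM.det_pos
  have hN := hM.inv.posSemidef
  have hNd : M⁻¹.det = M.det⁻¹ := by rw [Matrix.det_nonsing_inv, Ring.inverse_eq_inv']
  obtain ⟨m, hm, hm3⟩ := exists_cube_root (c := M.det⁻¹ * A.det)
    (mul_nonneg (inv_nonneg.2 hd.le) hA.det_nonneg)
  -- each trace `tr (M⁻¹ X)` is bounded below by `3 (det M⁻¹ * det X) ^ (1 / 3)`
  have bound : ∀ (X : Matrix (Fin 3) (Fin 3) ℝ) (k : ℕ), X.PosSemidef →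
      A.det * (r ^ k) ^ 3 ≤ X.det → 3 * (m * r ^ k) ≤ (M⁻¹ * X).trace := by
    intro X k hX hX'
    have h := hN.det_mul_det_le_trace_pow hX
    rw [hNd] at h
    have h2 : M.det⁻¹ * (A.det * (r ^ k) ^ 3) ≤ M.det⁻¹ * X.det :=
      mul_le_mul_of_nonneg_left hX' (inv_nonneg.2 hd.le)
    have h3 : (3 * (m * r ^ k)) ^ 3 ≤ (M⁻¹ * X).trace ^ 3 := by
      have : (3 * (m * r ^ k)) ^ 3 = 27 * (M.det⁻¹ * (A.det * (r ^ k) ^ 3)) := by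
        rw [← mul_assoc M.det⁻¹, ← hm3]; ring
      linarith
    exact (Odd.pow_le_pow (by decide : Odd 3)).1 h3
  have hA' := bound A 0 hA (by simp)
  have hB' := bound B 1 hB (by simpa using hAB)
  have hC' := bound C 2 hC (by rw [← pow_mul]; exact hAC)
  have htr : (M⁻¹ * A).trace + 2 * (M⁻¹ * B).trace + (M⁻¹ * C).trace = 3 := by
    have h1 : (M⁻¹ * (A + (2 : ℝ) • B + C)).trace = 3 := by
      rw [← hMdef, Matrix.nonsing_inv_mul _ (isUnit_iff_ne_zero.2 hd.ne')]
      simp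
    simpa [Matrix.mul_add] using h1
  have h1 : m * (1 + r) ^ 2 ≤ 1 := by nlinarith
  have h2 : (m * (1 + r) ^ 2) ^ 3 ≤ 1 := pow_le_one₀ (by positivity) h1
  rw [mul_pow, hm3, ← pow_mul, mul_assoc, inv_mul_le_iff₀ hd] at h2
  simpa using h2

/-! ### The forms of a four-point metric and of its square -/

lemma edgeSum_eq (x : Fin 4 → Fin 4 → ℝ) :
    edgeSum x = x 0 1 + x 0 2 + x 0 3 + x 1 2 + x 1 3 + x 2 3 := by
  have h : (Finset.univ.filter fun p : Fin 4 × Fin 4 => p.1 < p.2) =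
      {(0, 1), (0, 2), (0, 3), (1, 2), (1, 3), (2, 3)} := by decide
  rw [edgeSum, h]
  simp [Finset.sum_insert, add_assoc]



lemma four_point_of_dist {x : Fin 4 → Fin 4 → ℝ} (hs : ∀ i j, x i j = x j i)
    (ht : ∀ i j k, x i k ≤ x i j + x j k) :
    cayleyMenger (x 0 1 ^ 2) (x 0 2 ^ 2) (x 0 3 ^ 2) (x 1 2 ^ 2) (x 1 3 ^ 2) (x 2 3 ^ 2) ≤
        2 * cayleyMenger (x 0 1) (x 0 2) (x 0 3) (x 1 2) (x 1 3) (x 2 3) ^ 2 ∧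
      ∀ c0 c1 c2 c3 : ℝ, c0 + c1 + c2 + c3 = 0 →
        x 0 1 * (c0 * c1) + x 0 2 * (c0 * c2) + x 0 3 * (c0 * c3) + x 1 2 * (c1 * c2)
          + x 1 3 * (c1 * c3) + x 2 3 * (c2 * c3) ≤ 0 := by
  apply four_point
  · have := ht 1 0 2; have := hs 0 1; linarith
  · have := ht 1 0 3; have := hs 0 1; linarith
  · have := ht 2 0 3; have := hs 0 2; linarith
  · exact ht 0 1 2
  · exact ht 0 1 3
  · have := ht 2 1 3; have := hs 1 2; linarith
  · have := ht 0 2 1; have := hs 1 2; linarith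
  · exact ht 0 2 3
  · exact ht 1 2 3
  · have := ht 0 3 1; have := hs 1 3; linarith
  · have := ht 0 3 2; have := hs 2 3; linarith
  · have := ht 1 3 2; have := hs 2 3; linarith

/-- The form of the distance itself, unsquared, is positive semidefinite: every metric on four points
is a nonnegative combination of cut metrics, each of which contributes a square. -/
lemma posSemidef_dissimGram {x : Fin 4 → Fin 4 → ℝ} (hs : ∀ i j, x i j = x j i)
    (h0 : ∀ i, x i i = 0) (ht : ∀ i j k, x i k ≤ x i j + x j k) : (dissimGram x).PosSemidef := by
  refine .of_dotProduct_mulVec_nonneg ?_ fun y => ?_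
  · ext i j
    simp only [Matrix.conjTranspose_apply, dissimGram, Matrix.of_apply, star_trivial]
    rw [hs j.succ i.succ]; ring
  · have h := (four_point_of_dist hs ht).2 (-(y 0 + y 1 + y 2)) (y 0) (y 1) (y 2) (by ring)
    have e1 : (Fin.succ 0 : Fin 4) = 1 := rfl
    have e2 : (Fin.succ 1 : Fin 4) = 2 := rfl
    have e3 : (Fin.succ 2 : Fin 4) = 3 := rfl
    simp only [dotProduct, Matrix.mulVec, Fin.sum_univ_three, dissimGram, Matrix.of_apply,
      star_trivial, Pi.star_apply, e1, e2, e3, h0, hs 1 0, hs 2 0, hs 3 0, hs 2 1, hs 3 1, hs 3 2]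
    linarith

/-- The determinant of the Gram matrix is log-convex along the powers `0`, `1`, `2` of the
distance: `det A * det C ≤ det B ^ 2`, where `C` comes from the discrete metric and has
determinant `1 / 2`. -/
lemma det_dissimGram_sq_le {x : Fin 4 → Fin 4 → ℝ} (hs : ∀ i j, x i j = x j i)
    (h0 : ∀ i, x i i = 0) (ht : ∀ i j k, x i k ≤ x i j + x j k) :
    (dissimGram fun i j => x i j ^ 2).det ≤ 2 * (dissimGram x).det ^ 2 := by
  rw [det_dissimGram x hs h0, det_dissimGram _ (fun i j => by rw [hs i j]) (by simp [h0])]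
  exact (four_point_of_dist hs ht).1

/-- The discrete metric on four points. -/
def discreteDist : Fin 4 → Fin 4 → ℝ := fun i j => if i = j then 0 else 1

lemma det_dissimGram_discreteDist : (dissimGram discreteDist).det = 1 / 2 := by
  rw [det_dissimGram _ (by simp [discreteDist, eq_comm]) (by simp [discreteDist])]
  simp [discreteDist, cayleyMenger]
  norm_num

lemma posDef_dissimGram_discreteDist : (dissimGram discreteDist).PosDef := by
  have h : (dissimGram discreteDist).PosSemidef := by
    apply posSemidef_dissimGram
    · simp [discreteDist, eq_comm]
    · simp [discreteDist]
    · intro i j k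
      unfold discreteDist
      split_ifs <;> simp_all
  rw [h.posDef_iff_det_ne_zero, det_dissimGram_discreteDist]
  norm_num

/-- The arithmetic-geometric mean inequality for the form of `x` relative to that of the discrete
metric, whose relative trace is half the edge sum. -/
lemma det_dissimGram_le_edgeSum {x : Fin 4 → Fin 4 → ℝ} (hs : ∀ i j, x i j = x j i)
    (h0 : ∀ i, x i i = 0) (ht : ∀ i j k, x i k ≤ x i j + x j k) :
    2 * (dissimGram x).det ≤ (edgeSum x / 6) ^ 3 := by
  have h := posDef_dissimGram_discreteDist.inv.posSemidef.det_mul_det_le_trace_pow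
    (posSemidef_dissimGram hs h0 ht)
  have e1 : (Fin.succ 0 : Fin 4) = 1 := rfl
  have e2 : (Fin.succ 1 : Fin 4) = 2 := rfl
  have e3 : (Fin.succ 2 : Fin 4) = 3 := rfl
  have hC : dissimGram discreteDist = !![1, 1 / 2, 1 / 2; 1 / 2, 1, 1 / 2; 1 / 2, 1 / 2, 1] := by
    ext i j
    fin_cases i <;> fin_cases j <;> norm_num [dissimGram, discreteDist]
  have hinv : (dissimGram discreteDist)⁻¹ =
      !![3 / 2, -1 / 2, -1 / 2; -1 / 2, 3 / 2, -1 / 2; -1 / 2, -1 / 2, 3 / 2] := by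
    apply Matrix.inv_eq_right_inv
    rw [hC, Matrix.mul_fin_three, Matrix.one_fin_three]
    norm_num
  have htr : ((dissimGram discreteDist)⁻¹ * dissimGram x).trace = edgeSum x / 2 := by
    rw [hinv, edgeSum_eq, Matrix.trace_fin_three]
    simp only [Matrix.mul_apply, Fin.sum_univ_three, dissimGram, Matrix.of_apply, e1, e2, e3, h0,
      hs 1 0, hs 2 0, hs 3 0, hs 2 1, hs 3 1, hs 3 2, Matrix.cons_val]
    ring
  rw [htr, Matrix.det_nonsing_inv, det_dissimGram_discreteDist, Ring.inverse_eq_inv'] at h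
  norm_num at h
  linarith

lemma dissimGram_mul_left (c : ℝ) (x : Fin 4 → Fin 4 → ℝ) :
    dissimGram (fun i j => c * x i j) = c • dissimGram x := by
  ext i j
  simp only [dissimGram, Matrix.of_apply, Matrix.smul_apply, smul_eq_mul]
  ring

/-- The expansion `(x + 1) ^ 2 = x ^ 2 + 2 x + 1` off the diagonal. -/
lemma dissimGram_add_one_sq {x : Fin 4 → Fin 4 → ℝ} (h0 : ∀ i, x i i = 0) :
    dissimGram (fun i j => if i = j then 0 else (x i j + 1) ^ 2) =
      dissimGram (fun i j => x i j ^ 2) + (2 : ℝ) • dissimGram x + dissimGram discreteDist := by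
  ext i j
  simp only [dissimGram, Matrix.of_apply, Matrix.add_apply, Matrix.smul_apply, discreteDist,
    smul_eq_mul, Fin.succ_ne_zero, if_false]
  split_ifs with h
  · rw [h, h0]; ring
  · ring

/-- The determinant form of the volume bound. -/
lemma det_dissimGram_mul_pow_le {x : Fin 4 → Fin 4 → ℝ} (hs : ∀ i j, x i j = x j i)
    (h0 : ∀ i, x i i = 0) (ht : ∀ i j k, x i k ≤ x i j + x j k) (hS : 0 < edgeSum x)
    (hA : (dissimGram fun i j => x i j ^ 2).PosSemidef) :
    (dissimGram fun i j => x i j ^ 2).det * (1 + 6 / edgeSum x) ^ 6 ≤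
      (dissimGram fun i j => if i = j then 0 else (x i j + 1) ^ 2).det := by
  have hB := posSemidef_dissimGram hs h0 ht
  have hC := posDef_dissimGram_discreteDist
  rw [dissimGram_add_one_sq h0]
  -- with `s` a sixth of the edge sum: `a ≤ 2 * b ^ 2` and `2 * b ≤ s ^ 3`
  have h1 := det_dissimGram_sq_le hs h0 ht
  have h2 := det_dissimGram_le_edgeSum hs h0 ht
  have hBd := hB.det_nonneg
  set a := (dissimGram fun i j => x i j ^ 2).det
  set b := (dissimGram x).det
  set s := edgeSum x / 6 with hs'
  have hspos : 0 < s := by positivity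
  have hr : 6 / edgeSum x = s⁻¹ := by rw [hs']; simp
  have hab : a * s⁻¹ ^ 3 ≤ b := by
    rw [inv_pow, ← div_eq_mul_inv, div_le_iff₀ (by positivity)]
    nlinarith
  refine det_mul_pow_le_det_add (by positivity) hA hB hC.posSemidef
    (hC.posSemidef_add (hA.add (hB.smul (by norm_num)))) (by rwa [hr]) ?_
  rw [hr, det_dissimGram_discreteDist]
  calc a * s⁻¹ ^ 6 = a * s⁻¹ ^ 3 * s⁻¹ ^ 3 := by ring
    _ ≤ b * s⁻¹ ^ 3 := by gcongr
    _ ≤ 1 / 2 := by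
      rw [inv_pow, ← div_eq_mul_inv, div_le_iff₀ (by positivity)]
      linarith

/-! ### Gram matrices and volumes of tetrahedra -/

/-- The vectors from the vertex `V 0` to the three other vertices. -/
noncomputable def edgeVec (V : Fin 4 → R3) : Fin 3 → R3 := fun i => V i.succ - V 0

lemma gram_edgeVec (V : Fin 4 → R3) :
    Matrix.gram ℝ (edgeVec V) = dissimGram fun i j => ‖V i - V j‖ ^ 2 := by
  ext i j
  rw [Matrix.gram_apply, real_inner_eq_norm_mul_self_add_norm_mul_self_sub_norm_sub_mul_self_div_two]
  simp only [edgeVec, dissimGram, Matrix.of_apply, sub_sub_sub_cancel_right]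
  ring

lemma affineIndependent_iff_linearIndependent_edgeVec (V : Fin 4 → R3) :
    AffineIndependent ℝ V ↔ LinearIndependent ℝ (edgeVec V) := by
  rw [affineIndependent_iff_linearIndependent_vsub ℝ V 0,
    ← linearIndependent_equiv (finSuccAboveEquiv (0 : Fin 4))]
  rfl

/-- The vertices of the corner of the unit cube: the origin and the three unit vectors. -/
noncomputable def corner : Fin 4 → R3 :=
  Fin.cons 0 fun i => EuclideanSpace.single i 1

lemma tetVolume_pos {V : Fin 4 → R3} (hV : AffineIndependent ℝ V) : 0 < tetVolume V := by
  have hspan : affineSpan ℝ (Set.range V) = ⊤ := by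
    rw [hV.affineSpan_eq_top_iff_card_eq_finrank_add_one]
    simp
  have hint := interior_convexHull_nonempty_iff_affineSpan_eq_top.2 hspan
  have hc : IsCompact (convexHull ℝ (Set.range V)) := (Set.finite_range V).isCompact_convexHull ℝ
  exact ENNReal.toReal_pos (Measure.measure_pos_of_nonempty_interior _ hint).ne'
    hc.measure_lt_top.ne

lemma affineIndependent_corner : AffineIndependent ℝ corner := by
  rw [affineIndependent_iff_linearIndependent_edgeVec]
  have : edgeVec corner = EuclideanSpace.basisFun (Fin 3) ℝ := by
    ext i; simp [edgeVec, corner]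
  rw [this]
  exact (EuclideanSpace.basisFun (Fin 3) ℝ).toBasis.linearIndependent

open scoped Pointwise in
/-- The volume of a tetrahedron, in units of the volume of `corner`, is the square root of the Gram
determinant, being the Jacobian of the affine map that carries `corner` to `V`. -/
lemma tetVolume_eq_sqrt_det_gram (V : Fin 4 → R3) :
    tetVolume V = √(Matrix.gram ℝ (edgeVec V)).det * tetVolume corner := by
  let b := EuclideanSpace.basisFun (Fin 3) ℝ
  let m : Matrix (Fin 3) (Fin 3) ℝ := Matrix.of fun i j => b.repr (edgeVec V j) i
  let f : R3 →ₗ[ℝ] R3 := Matrix.toLin b.toBasis b.toBasis m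
  have hgram : (Matrix.gram ℝ (edgeVec V)).det = m.det ^ 2 := by
    rw [Matrix.gram_eq_conjTranspose_mul b, Matrix.det_mul, Matrix.det_conjTranspose,
      star_trivial, sq]
  have hf : ∀ i, f (b i) = edgeVec V i := by
    intro i
    have h := Matrix.toLin_self b.toBasis b.toBasis m i
    rw [OrthonormalBasis.coe_toBasis] at h
    exact h.trans (b.sum_repr (edgeVec V i))
  have hV : V = fun j => V 0 + f (corner j) := by
    funext j
    refine Fin.cases ?_ (fun i => ?_) j
    · simp [corner]
    · have : corner i.succ = b i := by simp [corner, b]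
      rw [this, hf, edgeVec]; abel
  have himg : convexHull ℝ (Set.range V) =
      (fun y => V 0 + y) '' (f '' convexHull ℝ (Set.range corner)) := by
    rw [f.image_convexHull, ← Set.range_comp]
    have h1 : Set.range V = (V 0 +ᵥ Set.range (f ∘ corner)) := by
      conv_lhs => rw [hV]
      ext y
      simp [Set.mem_vadd_set]
    rw [h1, convexHull_vadd]
    rfl
  rw [tetVolume, himg, Measure.real, Set.image_add_left, measure_preimage_add,
    Measure.addHaar_image_linearMap, LinearMap.det_toLin, hgram, Real.sqrt_sq_eq_abs,
    ENNReal.toReal_mul, ENNReal.toReal_ofReal (abs_nonneg _)]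
  rfl

lemma tetVolume_div_tetVolume (V W : Fin 4 → R3) :
    tetVolume W / tetVolume V =
      √((Matrix.gram ℝ (edgeVec W)).det / (Matrix.gram ℝ (edgeVec V)).det) := by
  rw [tetVolume_eq_sqrt_det_gram V, tetVolume_eq_sqrt_det_gram W,
    mul_div_mul_right _ _ (tetVolume_pos affineIndependent_corner).ne',
    Real.sqrt_div (Matrix.posSemidef_gram ℝ _).det_nonneg]

open scoped MatrixOrder in
/-- A positive semidefinite matrix `Kᴴ * K` is the Gram matrix of the columns of `K`. -/
lemma exists_gram_edgeVec_eq {M : Matrix (Fin 3) (Fin 3) ℝ} (hM : M.PosSemidef) :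
    ∃ W : Fin 4 → R3, Matrix.gram ℝ (edgeVec W) = M := by
  obtain ⟨K, rfl⟩ := CStarAlgebra.nonneg_iff_eq_star_mul_self.mp hM.nonneg
  refine ⟨Fin.cons 0 fun j => WithLp.toLp 2 fun i => K i j, ?_⟩
  rw [Matrix.gram_eq_conjTranspose_mul (EuclideanSpace.basisFun (Fin 3) ℝ)]
  rw [Matrix.star_eq_conjTranspose]
  congr 2 <;> ext i j <;> simp [edgeVec]

/-- A dissimilarity is recovered from its Gram matrix by polarization. -/
lemma dissimGram_injective {x y : Fin 4 → Fin 4 → ℝ} (hxs : ∀ i j, x i j = x j i)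
    (hx0 : ∀ i, x i i = 0) (hys : ∀ i j, y i j = y j i) (hy0 : ∀ i, y i i = 0)
    (h : dissimGram x = dissimGram y) : x = y := by
  have h1 : ∀ i j : Fin 3, x i.succ 0 + x j.succ 0 - x i.succ j.succ =
      y i.succ 0 + y j.succ 0 - y i.succ j.succ := by
    intro i j
    have := congrFun (congrFun h i) j
    simp only [dissimGram, Matrix.of_apply] at this
    linarith
  have h2 : ∀ i : Fin 3, x i.succ 0 = y i.succ 0 := by
    intro i
    have := h1 i i
    rw [hx0, hy0] at this
    linarith
  funext i j
  refine Fin.cases ?_ (fun i => ?_) i <;> refine Fin.cases ?_ (fun j => ?_) j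
  · rw [hx0, hy0]
  · rw [hxs, hys, h2]
  · exact h2 i
  · linarith [h1 i j, h2 i, h2 j]

/-! ### The lengthened tetrahedron -/

section Realization

variable (V : Fin 4 → R3)

lemma posSemidef_dissimGram_norm_sq : (dissimGram fun i j => ‖V i - V j‖ ^ 2).PosSemidef :=
  gram_edgeVec V ▸ Matrix.posSemidef_gram ℝ _

lemma posSemidef_dissimGram_norm : (dissimGram fun i j => ‖V i - V j‖).PosSemidef :=
  posSemidef_dissimGram (fun _ _ => norm_sub_rev _ _) (by simp)
    (fun _ _ _ => norm_sub_le_norm_sub_add_norm_sub _ _ _)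

/-- The squares of the lengthened distances are those of a nondegenerate tetrahedron, even when the
points `V i` are coplanar: the discrete metric contributes a positive definite form. -/
lemma posDef_dissimGram_lengthening :
    (dissimGram fun i j => if i = j then 0 else (‖V i - V j‖ + 1) ^ 2).PosDef := by
  rw [dissimGram_add_one_sq (x := fun i j => ‖V i - V j‖) (by simp)]
  exact posDef_dissimGram_discreteDist.posSemidef_add ((posSemidef_dissimGram_norm_sq V).add
    ((posSemidef_dissimGram_norm V).smul (by norm_num)))

end Realization

lemma gram_edgeVec_lengthening {d : Fin 4 → Fin 4 → ℝ} {V W : Fin 4 → R3} (hV : Realizes V d)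
    (hW : Realizes W (unitLengthening d)) :
    Matrix.gram ℝ (edgeVec W) =
      dissimGram fun i j => if i = j then 0 else (‖V i - V j‖ + 1) ^ 2 := by
  rw [gram_edgeVec]
  congr 1
  funext i j
  split_ifs with h
  · simp [h]
  · rw [← hW i j h, ← hV i j h, unitLengthening]

lemma IsTetrahedral.unitLengthening {d : Fin 4 → Fin 4 → ℝ} (hd : IsTetrahedral d) :
    IsTetrahedral (unitLengthening d) := by
  obtain ⟨V, -, hV⟩ := hd
  obtain ⟨W, hW⟩ := exists_gram_edgeVec_eq (posDef_dissimGram_lengthening V).posSemidef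
  rw [gram_edgeVec] at hW
  have h := dissimGram_injective (fun i j => by rw [norm_sub_rev]) (by simp)
    (fun i j => by simp only [eq_comm, norm_sub_rev]) (by simp) hW
  have hd' : ∀ i j, i ≠ j → ‖W i - W j‖ = ‖V i - V j‖ + 1 := by
    intro i j hij
    have := congrFun (congrFun h i) j
    rw [if_neg hij] at this
    exact (pow_left_inj₀ (norm_nonneg _) (by positivity) two_ne_zero).1 this
  refine ⟨W, fun i j hij => ?_, fun i j hij => ?_⟩
  · by_contra hne
    have := hd' i j hne
    rw [hij, sub_self, norm_zero] at this
    linarith [norm_nonneg (V i - V j)]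
  · rw [hd' i j hij, ← hV i j hij]; rfl

theorem theorem1p1 (d : Fin 4 → Fin 4 → ℝ) (hd : IsTetrahedral d) :
    IsTetrahedral (unitLengthening d) ∧
    ∀ V W : Fin 4 → R3, Realizes V d → Realizes W (unitLengthening d) →
      AffineIndependent ℝ V →
        AffineIndependent ℝ W ∧
        tetVolume W / tetVolume V ≥ (1 + 6 / edgeSum d) ^ 3 ∧
        ((∃ s : ℝ, ∀ i j, i ≠ j → d i j = s) →
          tetVolume W / tetVolume V = (1 + 6 / edgeSum d) ^ 3) := by
  refine ⟨hd.unitLengthening, fun V W hV hW hVi => ?_⟩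
  have hWgram := gram_edgeVec_lengthening hV hW
  have hpos : ∀ i j, i ≠ j → 0 < d i j := by
    intro i j hij
    rw [hV i j hij, norm_pos_iff, sub_ne_zero]
    exact hVi.injective.ne hij
  have hsum : edgeSum d = edgeSum fun i j => ‖V i - V j‖ := by
    simp only [edgeSum_eq]
    rw [hV 0 1 (by decide), hV 0 2 (by decide), hV 0 3 (by decide), hV 1 2 (by decide),
      hV 1 3 (by decide), hV 2 3 (by decide)]
  have hS : 0 < edgeSum d := by
    rw [edgeSum_eq]
    have := hpos 0 1 (by decide)
    have := hpos 0 2 (by decide)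
    have := hpos 0 3 (by decide)
    have := hpos 1 2 (by decide)
    have := hpos 1 3 (by decide)
    have := hpos 2 3 (by decide)
    positivity
  have hVdet : 0 < (Matrix.gram ℝ (edgeVec V)).det :=
    (Matrix.posDef_gram_of_linearIndependent
      ((affineIndependent_iff_linearIndependent_edgeVec V).1 hVi)).det_pos
  refine ⟨?_, ?_, ?_⟩
  · rw [affineIndependent_iff_linearIndependent_edgeVec, ← Matrix.posDef_gram_iff_linearIndependent,
      hWgram]
    exact posDef_dissimGram_lengthening V
  · rw [tetVolume_div_tetVolume]
    apply Real.le_sqrt_of_sq_le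
    rw [le_div_iff₀ hVdet, ← pow_mul, hsum, mul_comm, hWgram, gram_edgeVec]
    exact det_dissimGram_mul_pow_le (fun _ _ => norm_sub_rev _ _) (by simp)
      (fun _ _ _ => norm_sub_le_norm_sub_add_norm_sub _ _ _) (hsum ▸ hS)
      (posSemidef_dissimGram_norm_sq V)
  · rintro ⟨s, hs⟩
    have hs0 : 0 < s := hs 0 1 (by decide) ▸ hpos 0 1 (by decide)
    have hVs : ∀ i j, i ≠ j → ‖V i - V j‖ = s := fun i j h => by rw [← hV i j h, hs i j h]
    -- both Gram matrices are multiples of that of the regular tetrahedron of edge length one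
    have hgV : Matrix.gram ℝ (edgeVec V) = s ^ 2 • dissimGram discreteDist := by
      rw [gram_edgeVec, ← dissimGram_mul_left]
      congr 1
      funext i j
      by_cases h : i = j
      · simp [h, discreteDist]
      · simp [h, discreteDist, hVs i j h]
    have hgW : Matrix.gram ℝ (edgeVec W) = (s + 1) ^ 2 • dissimGram discreteDist := by
      rw [hWgram, ← dissimGram_mul_left]
      congr 1
      funext i j
      by_cases h : i = j
      · simp [h, discreteDist]
      · simp [h, discreteDist, hVs i j h]
    have hSs : edgeSum d = 6 * s := by
      rw [edgeSum_eq, hs 0 1 (by decide), hs 0 2 (by decide), hs 0 3 (by decide),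
        hs 1 2 (by decide), hs 1 3 (by decide), hs 2 3 (by decide)]
      ring
    have hratio : (Matrix.gram ℝ (edgeVec W)).det / (Matrix.gram ℝ (edgeVec V)).det =
        ((1 + 6 / edgeSum d) ^ 3) ^ 2 := by
      rw [hgV, hgW, Matrix.det_smul, Matrix.det_smul, det_dissimGram_discreteDist, hSs,
        Fintype.card_fin]
      field_simp
    rw [tetVolume_div_tetVolume, hratio, Real.sqrt_sq (by positivity)]
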